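/- Let $\mathrm{Homeo}^+(\mathbf{R}/\mathbf{Z})$ be the group of orientation-preserving homeomorphisms of the circle, let $\overline{\mathrm{Homeo}^+(\mathbf{R}/\mathbf{Z})}$ be the group of orientation-preserving homeomorphisms of $\mathbf{R}$ that commute with all integer translations, and let $\eta : \overline{\mathrm{Homeo}^+(\mathbf{R}/\mathbf{Z})} \to \mathrm{Homeo}^+(\mathbf{R}/\mathbf{Z})$ be the natural projection. For $f \in \overline{\mathrm{Homeo}^+(\mathbf{R}/\mathbf{Z})}$ let $\mathrm{rot}(f) := \lim_{n\to\infty} f^n(0)/n \in \mathbf{R}$ be its rotation number. For a group $\Gamma$ and $g$ in its commutator subgroup $\Gamma'$, let $\mathrm{cl}(g)$ be the least $n$ such that $g$ is a product of at most $n$ commutators of elements of $\Gamma$, and $\mathrm{scl}(g) := \lim_{n\to\infty} \mathrm{cl}(g^n)/n$. For arbitrary $g \in \Gamma$ put $\mathrm{scl}(g) := \mathrm{scl}(g^k)/k$ if $g^k \in \Gamma'$ for some $k \geq 1$ (this does not depend on $k$), and $\mathrm{scl}(g) := \infty$ otherwise. The defect of a function $\phi : \Gamma \to \mathbf{R}$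 is $D(\phi) := \sup_{g,h \in \Gamma} |\phi(g) + \phi(h) - \phi(gh)|$. **Theorem.** Let $G$ be a subgroup of $\mathrm{Homeo}^+(\mathbf{R}/\mathbf{Z})$, let $\overline{G} := \eta^{-1}(G)$ be its total lift, and let $D := D(\mathrm{rot}|_{\overline{G}})$ be the defect of the rotation number on $\overline{G}$. Suppose that $\mathrm{scl}(g) = 0$ for every $g \in G$, where $\mathrm{scl}$ is taken in $G$. Then either $D = 0$, or $$\mathrm{scl}(g) = \frac{|\mathrm{rot}(g)|}{2D}$$ for every $g$ in the commutator subgroup $\overline{G}'$ of $\overline{G}$, where $\mathrm{scl}$ is taken in $\overline{G}$. -/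

import Mathlib

open Filter Topology
open scoped ENNReal

namespace CircleScl

noncomputable section

/-! ### Stable commutator length -/

/-- The commutator length of `g`: the least `n` such that `g` is a product of at most `n`
commutators of elements of `Γ`. It is meaningful for `g ∈ commutator Γ` (for other `g` the set is
empty and the value is never used). -/
def cl {Γ : Type*} [Group Γ] (g : Γ) : ℕ :=
  sInf {n : ℕ | ∃ l : List Γ, l.length ≤ n ∧ (∀ c ∈ l, c ∈ commutatorSet Γ) ∧ l.prod = g}

/-- The limit `lim cl (g ^ n) / n`, for `g ∈ commutator Γ`. The limit exists, see
`tendsto_stableCl`. -/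
def stableCl {Γ : Type*} [Group Γ] (g : Γ) : ℝ :=
  limUnder atTop fun n : ℕ => (cl (g ^ n) : ℝ) / n

open Classical in
/-- Stable commutator length, with values in `[0, ∞]`: if some power `g ^ k` with `k ≥ 1` lies in
the commutator subgroup, it is `lim cl (g ^ (k n)) / (k n)` (the least such `k` is used, the value
does not depend on `k`, see `scl_eq_of_pow_mem`), and otherwise it is `∞`. -/
def scl {Γ : Type*} [Group Γ] (g : Γ) : ℝ≥0∞ :=
  if h : ∃ k : ℕ, 1 ≤ k ∧ g ^ k ∈ commutator Γ then
    ENNReal.ofReal (stableCl (g ^ Nat.find h) / (Nat.find h : ℝ))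
  else ∞

section

variable {Γ : Type*} [Group Γ]

theorem exists_list_of_mem_commutator {g : Γ} (hg : g ∈ commutator Γ) :
    ∃ l : List Γ, (∀ c ∈ l, c ∈ commutatorSet Γ) ∧ l.prod = g := by
  rw [commutator_eq_closure, ← Subgroup.mem_toSubmonoid, Subgroup.closure_toSubmonoid] at hg
  obtain ⟨l, hl, rfl⟩ := Submonoid.exists_list_of_mem_closure hg
  refine ⟨l, fun c hc => ?_, rfl⟩
  rcases hl c hc with h | h
  · exact h
  · obtain ⟨a, b, hab⟩ := h
    exact ⟨b, a, by rw [← commutatorElement_inv, hab, inv_inv]⟩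

theorem exists_list_length_le_cl {g : Γ} (hg : g ∈ commutator Γ) :
    ∃ l : List Γ, l.length ≤ cl g ∧ (∀ c ∈ l, c ∈ commutatorSet Γ) ∧ l.prod = g := by
  obtain ⟨l, hl, hp⟩ := exists_list_of_mem_commutator hg
  exact Nat.sInf_mem
    (s := {n : ℕ | ∃ l : List Γ, l.length ≤ n ∧ (∀ c ∈ l, c ∈ commutatorSet Γ) ∧ l.prod = g})
    ⟨l.length, l, le_rfl, hl, hp⟩

theorem cl_mul_le {g h : Γ} (hg : g ∈ commutator Γ) (hh : h ∈ commutator Γ) :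
    cl (g * h) ≤ cl g + cl h := by
  obtain ⟨l, hl, hlc, hlp⟩ := exists_list_length_le_cl hg
  obtain ⟨m, hm, hmc, hmp⟩ := exists_list_length_le_cl hh
  refine Nat.sInf_le ⟨l ++ m, ?_, ?_, ?_⟩
  · rw [List.length_append]; omega
  · intro c hc
    rcases List.mem_append.1 hc with h | h
    · exact hlc c h
    · exact hmc c h
  · rw [List.prod_append, hlp, hmp]

/-- The limit defining `stableCl` exists on the commutator subgroup. -/
theorem tendsto_stableCl {g : Γ} (hg : g ∈ commutator Γ) :
    Tendsto (fun n : ℕ => (cl (g ^ n) : ℝ) / n) atTop (𝓝 (stableCl g)) := by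
  have hs : Subadditive fun n : ℕ => (cl (g ^ n) : ℝ) := by
    intro m n
    simp only [pow_add]
    exact_mod_cast cl_mul_le (pow_mem hg m) (pow_mem hg n)
  have hb : BddBelow (Set.range fun n : ℕ => (cl (g ^ n) : ℝ) / n) :=
    ⟨0, by rintro _ ⟨n, rfl⟩; positivity⟩
  exact tendsto_nhds_limUnder ⟨_, hs.tendsto_lim hb⟩

theorem stableCl_pow {g : Γ} (hg : g ∈ commutator Γ) {k : ℕ} (hk : 1 ≤ k) :
    stableCl (g ^ k) = k * stableCl g := by
  refine tendsto_nhds_unique (tendsto_stableCl (pow_mem hg k)) ?_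
  have h1 : Tendsto (fun n : ℕ => k * n) atTop atTop :=
    tendsto_id.const_mul_atTop' (by omega)
  refine (((tendsto_stableCl hg).comp h1).const_mul (k : ℝ)).congr fun n => ?_
  have hk0 : (k : ℝ) ≠ 0 := by positivity
  rcases eq_or_ne n 0 with rfl | hn
  · simp
  have hn0 : (n : ℝ) ≠ 0 := by positivity
  simp only [Function.comp_apply, pow_mul, Nat.cast_mul]
  field_simp

/-- The value of `scl` may be computed from any power in the commutator subgroup. -/
theorem scl_eq_of_pow_mem {g : Γ} {k : ℕ} (hk : 1 ≤ k) (hg : g ^ k ∈ commutator Γ) :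
    scl g = ENNReal.ofReal (stableCl (g ^ k) / k) := by
  classical
  have h : ∃ k : ℕ, 1 ≤ k ∧ g ^ k ∈ commutator Γ := ⟨k, hk, hg⟩
  rw [scl, dif_pos h]
  obtain ⟨h1, h2⟩ := Nat.find_spec h
  congr 1
  generalize Nat.find h = j at h1 h2
  have e := stableCl_pow h2 hk
  rw [← pow_mul, mul_comm, pow_mul, stableCl_pow hg h1] at e
  have : (0 : ℝ) < j := by exact_mod_cast h1
  have : (0 : ℝ) < k := by exact_mod_cast hk
  field_simp
  linarith

end

/-- The defect `sup_{g, h} |φ g + φ h - φ (g h)| ∈ [0, ∞]` of a real function on a group. -/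
def defect {Γ : Type*} [Group Γ] (φ : Γ → ℝ) : ℝ≥0∞ :=
  ⨆ (g : Γ) (h : Γ), ENNReal.ofReal |φ g + φ h - φ (g * h)|

/-! ### Circle homeomorphisms and their lifts -/

/-- `Homeo⁺(ℝ/ℤ)`: the group of orientation preserving homeomorphisms of the circle, that is,
those that preserve the cyclic order. -/
def HomeoPlus : Subgroup (UnitAddCircle ≃ₜ UnitAddCircle) where
  carrier := {f | ∀ a b c : UnitAddCircle, btw (f a) (f b) (f c) ↔ btw a b c}
  mul_mem' {f g} hf hg a b c := (hf (g a) (g b) (g c)).trans (hg a b c)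
  one_mem' _ _ _ := Iff.rfl
  inv_mem' {f} hf a b c := by
    simpa using (hf (f⁻¹ a) (f⁻¹ b) (f⁻¹ c)).symm

/-- The group of orientation preserving homeomorphisms of the line that commute with the integer
translations. Mathlib's `CircleDeg1Lift` is the monoid of monotone `f : ℝ → ℝ` with
`f (x + 1) = f x + 1`; its units are the bijective ones, which are automatically increasing
homeomorphisms of `ℝ`. The group law is composition. -/
abbrev LiftedHomeoPlus : Type := CircleDeg1Liftˣ

theorem coe_unit_continuous (f : LiftedHomeoPlus) : Continuous (f : ℝ → ℝ) :=
  (CircleDeg1Lift.continuous_iff_surjective _).2 fun x =>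
    ⟨(f⁻¹ : LiftedHomeoPlus) x, CircleDeg1Lift.units_apply_inv_apply f x⟩

theorem coe_unit_strictMono (f : LiftedHomeoPlus) : StrictMono (f : ℝ → ℝ) :=
  (CircleDeg1Lift.toOrderIso f).strictMono

/-- The map of the circle induced by a lift: `x mod 1 ↦ f x mod 1`. -/
def inducedMap (f : LiftedHomeoPlus) : UnitAddCircle → UnitAddCircle :=
  Function.Periodic.lift (f := fun x : ℝ => ((f x : ℝ) : UnitAddCircle)) (c := (1 : ℝ)) fun x => by
    simp

@[simp]
theorem inducedMap_coe (f : LiftedHomeoPlus) (x : ℝ) :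
    inducedMap f (x : UnitAddCircle) = ((f x : ℝ) : UnitAddCircle) :=
  rfl

theorem continuous_inducedMap (f : LiftedHomeoPlus) : Continuous (inducedMap f) :=
  continuous_coinduced_dom.2 ((AddCircle.continuous_mk' 1).comp (coe_unit_continuous f))

/-- The homeomorphism of the circle induced by a lift. -/
def inducedHomeo (f : LiftedHomeoPlus) : UnitAddCircle ≃ₜ UnitAddCircle where
  toFun := inducedMap f
  invFun := inducedMap f⁻¹
  left_inv x := by
    induction x using QuotientAddGroup.induction_on with
    | H x => exact congrArg _ (CircleDeg1Lift.units_inv_apply_apply f x)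
  right_inv x := by
    induction x using QuotientAddGroup.induction_on with
    | H x => exact congrArg _ (CircleDeg1Lift.units_apply_inv_apply f x)
  continuous_toFun := continuous_inducedMap f
  continuous_invFun := continuous_inducedMap f⁻¹

theorem inducedHomeo_mem (f : LiftedHomeoPlus) : inducedHomeo f ∈ HomeoPlus := by
  intro a b c
  induction a using QuotientAddGroup.induction_on with | H a => ?_
  induction b using QuotientAddGroup.induction_on with | H b => ?_
  induction c using QuotientAddGroup.induction_on with | H c => ?_
  have hp : (0 : ℝ) < 1 := one_pos
  have h1 : toIcoMod hp (f a) (f b) = f (toIcoMod hp a b) := by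
    refine (toIcoMod_eq_iff hp).2 ⟨⟨?_, ?_⟩, toIcoDiv hp a b, ?_⟩
    · exact (coe_unit_strictMono f).monotone (left_le_toIcoMod hp a b)
    · rw [← CircleDeg1Lift.map_add_one]
      exact coe_unit_strictMono f (toIcoMod_lt_right hp a b)
    · rw [zsmul_one, ← CircleDeg1Lift.map_add_int]
      congr 1
      simpa using (toIcoMod_add_toIcoDiv_zsmul hp a b).symm
  have h2 : toIocMod hp (f a) (f c) = f (toIocMod hp a c) := by
    refine (toIocMod_eq_iff hp).2 ⟨⟨?_, ?_⟩, toIocDiv hp a c, ?_⟩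
    · exact coe_unit_strictMono f (left_lt_toIocMod hp a c)
    · rw [← CircleDeg1Lift.map_add_one]
      exact (coe_unit_strictMono f).monotone (toIocMod_le_right hp a c)
    · rw [zsmul_one, ← CircleDeg1Lift.map_add_int]
      congr 1
      simpa using (toIocMod_add_toIocDiv_zsmul hp a c).symm
  change btw ((f a : ℝ) : UnitAddCircle) ((f b : ℝ) : UnitAddCircle) ((f c : ℝ) : UnitAddCircle) ↔
    btw (a : UnitAddCircle) (b : UnitAddCircle) (c : UnitAddCircle)
  erw [QuotientAddGroup.btw_coe_iff, QuotientAddGroup.btw_coe_iff]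
  rw [h1, h2, (coe_unit_strictMono f).le_iff_le]

/-- The projection from the lifted group onto `Homeo⁺(ℝ/ℤ)`. -/
def eta : LiftedHomeoPlus →* HomeoPlus where
  toFun f := ⟨inducedHomeo f, inducedHomeo_mem f⟩
  map_one' := by
    ext x
    induction x using QuotientAddGroup.induction_on with | H x => rfl
  map_mul' f g := by
    ext x
    induction x using QuotientAddGroup.induction_on with | H x => rfl

/-- The total lift of `G ≤ Homeo⁺(ℝ/ℤ)` to the line: the full preimage of `G`. -/
def totalLift (G : Subgroup HomeoPlus) : Subgroup LiftedHomeoPlus :=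
  G.comap eta

/-- The rotation number `lim f^n(0) / n` of an element of the lifted group (Mathlib's translation
number, see `CircleDeg1Lift.tendsto_translation_number₀` for the limit). -/
def rot (f : LiftedHomeoPlus) : ℝ :=
  CircleDeg1Lift.translationNumber (f : CircleDeg1Lift)

end

end CircleScl

/-! The total lift is a central extension of `G` by the powers of the unit translation `T`, and `φ =
rot` is a homogeneous quasimorphism on it with `φ T = 1`. Lower bound (the easy half of Bavard
duality): a product of `n` commutators has `|φ| ≤ 2 D n`, so `|φ g| ≤ 2 D scl g`
(`abs_le_stableCl`). Upper bound: as `scl` vanishes on `G`, every lift has a power `T ^ m * p` with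
`p` a product of few commutators relative to the exponent `k`, and then `m ≈ k φ`. Apply this to
`a`, `b` and `a b`, and compare `(a b) ^ (2 K)` with `a ^ (2 K) b ^ (2 K)`, which differ by only `K`
commutators (`isCommProd_mul_pow`). With `δ = |φ a + φ b - φ (a b)|`, a power of `T` of size about
`2 K δ` becomes a product of about `K` commutators, so a unit of translation costs about `1 / (2
δ)`. Since `g ^ k` is about `T ^ (k φ g)`, this gives `2 δ scl g ≤ |φ g|` (`stableCl_mul_le`); the
supremum over `a`, `b` replaces `δ` by `D`. -/

open scoped commutatorElement

namespace CircleScl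

/-! ### Products of boundedly many commutators -/

section Group

variable {Γ : Type*} [Group Γ]

/-- `g` is a product of at most `n` commutators. -/
def IsCommProd (n : ℕ) (g : Γ) : Prop :=
  ∃ l : List Γ, l.length ≤ n ∧ (∀ c ∈ l, c ∈ commutatorSet Γ) ∧ l.prod = g

theorem IsCommProd.one : IsCommProd 0 (1 : Γ) := ⟨[], by simp⟩

theorem IsCommProd.mul {m n : ℕ} {g h : Γ} (hg : IsCommProd m g) (hh : IsCommProd n h) :
    IsCommProd (m + n) (g * h) := by
  obtain ⟨l, hl, hlc, rfl⟩ := hg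
  obtain ⟨l', hl', hlc', rfl⟩ := hh
  refine ⟨l ++ l', by rw [List.length_append]; omega, fun c hc => ?_, List.prod_append⟩
  exact (List.mem_append.1 hc).elim (hlc c) (hlc' c)

theorem IsCommProd.inv {n : ℕ} {g : Γ} (hg : IsCommProd n g) : IsCommProd n g⁻¹ := by
  obtain ⟨l, hl, hlc, rfl⟩ := hg
  refine ⟨(l.map fun x => x⁻¹).reverse, by simpa using hl, fun c hc => ?_,
    (List.prod_inv_reverse l).symm⟩
  simp only [List.mem_reverse, List.mem_map] at hc
  obtain ⟨x, hx, rfl⟩ := hc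
  obtain ⟨a, b, rfl⟩ := hlc x hx
  exact ⟨b, a, (commutatorElement_inv a b).symm⟩

theorem IsCommProd.pow {n : ℕ} {g : Γ} (hg : IsCommProd n g) (k : ℕ) :
    IsCommProd (k * n) (g ^ k) := by
  induction k with
  | zero => simpa using IsCommProd.one
  | succ k ih => rw [pow_succ, Nat.succ_mul]; exact ih.mul hg

theorem IsCommProd.zpow {n : ℕ} {g : Γ} (hg : IsCommProd n g) (k : ℤ) :
    IsCommProd (k.natAbs * n) (g ^ k) := by
  obtain ⟨j, rfl | rfl⟩ := k.eq_nat_or_neg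
  · simpa using hg.pow j
  · simpa using (hg.pow j).inv

theorem isCommProd_conj_commutatorElement (u x y : Γ) : IsCommProd 1 (u * ⁅x, y⁆ * u⁻¹) :=
  ⟨[u * ⁅x, y⁆ * u⁻¹], by simp, by
    simpa using ⟨u * x * u⁻¹, u * y * u⁻¹, (conjugate_commutatorElement x y u).symm⟩, by simp⟩

theorem IsCommProd.cl_le {n : ℕ} {g : Γ} (hg : IsCommProd n g) : cl g ≤ n := Nat.sInf_le hg

/-- `(a b) ^ (2 m)` and `a ^ (2 m) b ^ (2 m)` differ by a product of `m` commutators. -/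
theorem isCommProd_mul_pow (a b : Γ) (m : ℕ) :
    ∃ s : Γ, IsCommProd m s ∧ (a * b) ^ (2 * m) = s * (a ^ (2 * m) * b ^ (2 * m)) := by
  induction m with
  | zero => exact ⟨1, IsCommProd.one, by simp⟩
  | succ m ih =>
    obtain ⟨s, hs, h⟩ := ih
    -- A single commutator absorbs two new factors `a b`; this rate of one half gives the sharp
    -- constant. The second entry is `u⁻¹ * a ^ (2 * m + 2)`, with `u` the conjugator, so that the
    -- tail of the conjugated commutator cancels.
    refine ⟨_, hs.mul (isCommProd_conj_commutatorElement
      (a ^ (2 * m + 1) * (a⁻¹ * b ^ (2 * m) * a)) (b * a ^ 2)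
      ((a⁻¹ * b ^ (2 * m) * a)⁻¹ * a)), ?_⟩
    rw [show 2 * (m + 1) = 2 * m + 2 by ring, pow_add, h]
    simp only [commutatorElement_def, pow_add, pow_two]
    group

/-- A homogeneous quasimorphism of defect at most `d` is at most `2 d n` on products of `n`
commutators. -/
theorem IsCommProd.abs_map_le {φ : Γ → ℝ} {d : ℝ} (hφ1 : φ 1 = 0) (hinv : ∀ g, φ g⁻¹ = -φ g)
    (hconj : ∀ g h, φ (h * g * h⁻¹) = φ g) (hd : ∀ g h, |φ g + φ h - φ (g * h)| ≤ d)
    {n : ℕ} {g : Γ} (hg : IsCommProd n g) : |φ g| ≤ 2 * d * n := by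
  have hd0 : 0 ≤ d := (abs_nonneg _).trans (hd 1 1)
  obtain ⟨l, hl, hlc, rfl⟩ := hg
  have key : ∀ l : List Γ, (∀ c ∈ l, c ∈ commutatorSet Γ) → |φ l.prod| ≤ 2 * d * l.length := by
    intro l
    induction l with
    | nil => simp [hφ1]
    | cons c l ih =>
      intro h
      have h1 := ih fun x hx => h x (List.mem_cons_of_mem _ hx)
      obtain ⟨a, b, rfl⟩ := h c List.mem_cons_self
      -- The values at `a b a⁻¹` and `b⁻¹` cancel, so `|φ ⁅a, b⁆| ≤ d`; joining it to the rest of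
      -- the product costs another `d`.
      have h2 := hd (a * b * a⁻¹) b⁻¹
      rw [hconj, hinv, ← commutatorElement_def] at h2
      have h3 := hd ⁅a, b⁆ l.prod
      rw [List.prod_cons, List.length_cons]
      push_cast
      rw [abs_le] at h1 h2 h3 ⊢
      constructor <;> linarith [h1.1, h1.2, h2.1, h2.2, h3.1, h3.2]
  refine (key l hlc).trans ?_
  gcongr

theorem stableCl_nonneg {g : Γ} (hg : g ∈ commutator Γ) : 0 ≤ stableCl g :=
  ge_of_tendsto' (tendsto_stableCl hg) fun n => by positivity

theorem stableCl_le_cl {g : Γ} (hg : g ∈ commutator Γ) : stableCl g ≤ cl g := by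
  refine le_of_tendsto' (tendsto_stableCl hg) fun n => ?_
  rcases eq_or_ne n 0 with rfl | hn
  · simp
  have h := (IsCommProd.pow (exists_list_length_le_cl hg) n).cl_le
  rw [div_le_iff₀ (by positivity), mul_comm]
  exact_mod_cast h

theorem scl_of_mem_commutator {g : Γ} (hg : g ∈ commutator Γ) :
    scl g = ENNReal.ofReal (stableCl g) := by
  simpa using scl_eq_of_pow_mem (g := g) le_rfl (by simpa using hg)

/-- If `scl g = 0` then some positive power of `g` is a product of arbitrarily few commutators,
relative to the exponent. -/
theorem exists_pow_isCommProd_of_scl_eq_zero {g : Γ} (hg : scl g = 0) {ε : ℝ} (hε : 0 < ε) :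
    ∃ k c : ℕ, 1 ≤ k ∧ (c : ℝ) ≤ ε * k ∧ IsCommProd c (g ^ k) := by
  have h : ∃ k : ℕ, 1 ≤ k ∧ g ^ k ∈ commutator Γ := by
    by_contra h
    rw [scl, dif_neg h] at hg
    exact ENNReal.top_ne_zero hg
  obtain ⟨k, hk, hgk⟩ := h
  have hk0 : (0 : ℝ) < k := by exact_mod_cast hk
  rw [scl_eq_of_pow_mem hk hgk, ENNReal.ofReal_eq_zero, div_le_iff₀ hk0, zero_mul] at hg
  obtain ⟨n, hn, hn1⟩ := (((tendsto_stableCl hgk).eventually_lt_const (hg.trans_lt hε)).and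
    (eventually_ge_atTop 1)).exists
  have hn0 : (0 : ℝ) < n := by exact_mod_cast hn1
  refine ⟨k * n, cl ((g ^ k) ^ n), Nat.mul_pos hk hn1, ?_, ?_⟩
  · rw [div_lt_iff₀ hn0] at hn
    push_cast
    have : (1 : ℝ) ≤ k := by exact_mod_cast hk
    nlinarith [mul_pos hε hn0]
  · rw [pow_mul]
    exact exists_list_length_le_cl (pow_mem hgk n)

end Group


/-! ### Homogeneous quasimorphisms on central extensions -/

section Extension

variable {Γ H : Type*} [Group Γ] [Group H]

/-- Commutators lift to commutators of arbitrary lifts of their entries, so the count does not grow.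
-/
theorem IsCommProd.exists_map_eq {π : Γ →* H} (hπ : Function.Surjective π) {n : ℕ} {h : H}
    (hh : IsCommProd n h) : ∃ p : Γ, IsCommProd n p ∧ π p = h := by
  obtain ⟨l, hl, hlc, rfl⟩ := hh
  induction l generalizing n with
  | nil => exact ⟨1, ⟨[], by simp⟩, by simp⟩
  | cons c l ih =>
    obtain ⟨p, hp, hpl⟩ := ih le_rfl fun x hx => hlc x (List.mem_cons_of_mem _ hx)
    obtain ⟨a, b, rfl⟩ := hlc c List.mem_cons_self
    obtain ⟨a, rfl⟩ := hπ a
    obtain ⟨b, rfl⟩ := hπ b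
    obtain ⟨l', hl', hlc', rfl⟩ := hp
    refine ⟨⁅a, b⁆ * l'.prod, ⟨⁅a, b⁆ :: l', ?_, ?_, by simp⟩, by
      simp [map_commutatorElement, hpl]⟩
    · simp only [List.length_cons] at hl ⊢; omega
    · simp only [List.mem_cons, forall_eq_or_imp]
      exact ⟨⟨a, b, rfl⟩, hlc'⟩

/-- A homogeneous quasimorphism of defect at most `d` on a central extension `π : Γ → H` by a cyclic
group generated by `T`, normalised by `φ T = 1`. -/
structure IsCentralQuasimorphism (π : Γ →* H) (T : Γ) (φ : Γ → ℝ) (d : ℝ) : Prop where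
  surjective : Function.Surjective π
  commute : ∀ g, Commute T g
  exists_zpow : ∀ g, π g = 1 → ∃ m : ℤ, g = T ^ m
  map_pow : ∀ (g : Γ) (n : ℕ), φ (g ^ n) = n * φ g
  map_inv : ∀ g, φ g⁻¹ = -φ g
  map_conj : ∀ g h, φ (h * g * h⁻¹) = φ g
  map_zpow_mul : ∀ (m : ℤ) (g : Γ), φ (T ^ m * g) = m + φ g
  defect_le : ∀ g h, |φ g + φ h - φ (g * h)| ≤ d

namespace IsCentralQuasimorphism

variable {π : Γ →* H} {T : Γ} {φ : Γ → ℝ} {d : ℝ}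

theorem abs_map_le (hφ : IsCentralQuasimorphism π T φ d) {n : ℕ} {g : Γ} (hg : IsCommProd n g) :
    |φ g| ≤ 2 * d * n :=
  hg.abs_map_le (by simpa using hφ.map_pow 1 0) hφ.map_inv hφ.map_conj hφ.defect_le

theorem nonneg (hφ : IsCentralQuasimorphism π T φ d) : 0 ≤ d :=
  (abs_nonneg _).trans (hφ.defect_le 1 1)

/-- The easy half of Bavard duality: bound `φ (g ^ n) = n * φ g` by the commutator length of `g ^ n`
and divide by `n`. -/
theorem abs_le_stableCl (hφ : IsCentralQuasimorphism π T φ d) {g : Γ} (hg : g ∈ commutator Γ) :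
    |φ g| ≤ 2 * d * stableCl g := by
  refine ge_of_tendsto ((tendsto_stableCl hg).const_mul (2 * d)) ?_
  filter_upwards [eventually_ge_atTop 1] with n hn
  have hn0 : (0 : ℝ) < n := by exact_mod_cast hn
  have h := hφ.abs_map_le (exists_list_length_le_cl (pow_mem hg n))
  rw [hφ.map_pow, abs_mul, Nat.abs_cast] at h
  rw [← mul_div_assoc, le_div_iff₀ hn0]
  linarith

/-- If `scl` vanishes on the quotient, then every element has a power that is a central element
times a product of few commutators. -/
theorem exists_pow_eq (hφ : IsCentralQuasimorphism π T φ d) (hH : ∀ h : H, scl h = 0) (g : Γ)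
    {ε : ℝ} (hε : 0 < ε) :
    ∃ (k c : ℕ) (m : ℤ) (p : Γ), 1 ≤ k ∧ (c : ℝ) ≤ ε * k ∧ IsCommProd c p ∧ g ^ k = T ^ m * p := by
  obtain ⟨k, c, hk, hc, h⟩ := exists_pow_isCommProd_of_scl_eq_zero (hH (π g)) hε
  obtain ⟨p, hp, hpg⟩ := h.exists_map_eq hφ.surjective
  obtain ⟨m, hm⟩ := hφ.exists_zpow (g ^ k * p⁻¹) (by simp [hpg])
  exact ⟨k, c, m, p, hk, hc, hp, by rw [← hm]; group⟩

theorem pow_zpow_mul (hφ : IsCentralQuasimorphism π T φ d) (m : ℤ) (p : Γ) (j : ℕ) :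
    (T ^ m * p) ^ j = T ^ (m * j) * p ^ j := by
  rw [((hφ.commute p).zpow_left m).mul_pow, zpow_mul, zpow_natCast]

/-- The difference is exactly `φ p`, which is small when `p` needs few commutators. -/
theorem abs_sub_le (hφ : IsCentralQuasimorphism π T φ d) {g p : Γ} {k c : ℕ} {m : ℤ}
    (hp : IsCommProd c p) (h : g ^ k = T ^ m * p) : |k * φ g - m| ≤ 2 * d * c := by
  have h1 := congrArg φ h
  rw [hφ.map_pow, hφ.map_zpow_mul] at h1
  simpa [h1] using hφ.abs_map_le hp

/-- If `scl` vanishes on the quotient, the additivity failure of `φ` at a pair `(a, b)` makes a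
power of the central element a product of few commutators. -/
theorem exists_isCommProd_zpow (hφ : IsCentralQuasimorphism π T φ d) (hH : ∀ h : H, scl h = 0)
    (a b : Γ) {ε : ℝ} (hε : 0 < ε) :
    ∃ (K : ℕ) (M : ℤ) (n : ℕ), 1 ≤ K ∧ (n : ℝ) ≤ (1 / 2 + 3 * ε) * K ∧ IsCommProd n (T ^ M) ∧
      K * (|φ a + φ b - φ (a * b)| - 6 * d * ε) ≤ |(M : ℝ)| := by
  obtain ⟨k₁, c₁, m₁, p₁, hk₁, hc₁, hp₁, h₁⟩ := hφ.exists_pow_eq hH a hε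
  obtain ⟨k₂, c₂, m₂, p₂, hk₂, hc₂, hp₂, h₂⟩ := hφ.exists_pow_eq hH b hε
  obtain ⟨k₃, c₃, m₃, p₃, hk₃, hc₃, hp₃, h₃⟩ := hφ.exists_pow_eq hH (a * b) hε
  -- a common exponent for the three powers
  have key : ∀ (x p : Γ) (k c j : ℕ) (m : ℤ), (c : ℝ) ≤ ε * k → IsCommProd c p →
      x ^ k = T ^ m * p → ∃ (c' : ℕ) (m' : ℤ) (p' : Γ), (c' : ℝ) ≤ ε * (k * j : ℕ) ∧
        IsCommProd c' p' ∧ x ^ (k * j) = T ^ m' * p' := by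
    intro x p k c j m hc hp h
    refine ⟨j * c, m * j, p ^ j, ?_, hp.pow j, by rw [pow_mul, h, hφ.pow_zpow_mul]⟩
    push_cast
    nlinarith [mul_le_mul_of_nonneg_right hc (Nat.cast_nonneg (α := ℝ) j)]
  -- The extra factor 2 makes the common exponent even, as `isCommProd_mul_pow` requires. Below,
  -- `dᵢ` counts commutators and `nᵢ` is the exponent of `T`.
  obtain ⟨d₁, n₁, q₁, hd₁, hq₁, e₁⟩ := key a p₁ k₁ c₁ (2 * (k₂ * k₃)) m₁ hc₁ hp₁ h₁
  obtain ⟨d₂, n₂, q₂, hd₂, hq₂, e₂⟩ := key b p₂ k₂ c₂ (2 * (k₁ * k₃)) m₂ hc₂ hp₂ h₂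
  obtain ⟨d₃, n₃, q₃, hd₃, hq₃, e₃⟩ := key (a * b) p₃ k₃ c₃ (2 * (k₁ * k₂)) m₃ hc₃ hp₃ h₃
  have hK : 1 ≤ k₁ * k₂ * k₃ := Nat.mul_pos (Nat.mul_pos hk₁ hk₂) hk₃
  generalize hKd : k₁ * k₂ * k₃ = K at hK
  rw [show k₁ * (2 * (k₂ * k₃)) = 2 * K by rw [← hKd]; ring] at hd₁ e₁
  rw [show k₂ * (2 * (k₁ * k₃)) = 2 * K by rw [← hKd]; ring] at hd₂ e₂
  rw [show k₃ * (2 * (k₁ * k₂)) = 2 * K by rw [← hKd]; ring] at hd₃ e₃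
  obtain ⟨s, hs, e⟩ := isCommProd_mul_pow a b K
  have b₁ := hφ.abs_sub_le hq₁ e₁
  have b₂ := hφ.abs_sub_le hq₂ e₂
  have b₃ := hφ.abs_sub_le hq₃ e₃
  -- The main term `K` of the count is half the exponent `2 * K`; each `dᵢ` adds at most `ε * (2 *
  -- K)`.
  refine ⟨2 * K, n₃ - n₁ - n₂, K + d₁ + d₂ + d₃, by omega, ?_, ?_, ?_⟩
  · push_cast at hd₁ hd₂ hd₃ ⊢
    linarith
  · have : T ^ (n₃ - n₁ - n₂) = s * q₁ * q₂ * q₃⁻¹ := by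
      rw [e₁, e₂, e₃] at e
      have c₂ : q₁ * T ^ n₂ = T ^ n₂ * q₁ := ((hφ.commute q₁).zpow_left n₂).eq.symm
      have cs : s * T ^ (n₁ + n₂) = T ^ (n₁ + n₂) * s :=
        ((hφ.commute s).zpow_left (n₁ + n₂)).eq.symm
      have e' : T ^ n₃ * q₃ = T ^ (n₁ + n₂) * (s * q₁ * q₂) := by
        rw [e]
        calc s * (T ^ n₁ * q₁ * (T ^ n₂ * q₂)) = s * (T ^ n₁ * (q₁ * T ^ n₂) * q₂) := by group
          _ = s * T ^ (n₁ + n₂) * (q₁ * q₂) := by rw [c₂]; group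
          _ = _ := by rw [cs]; group
      rw [eq_mul_inv_iff_mul_eq, show n₃ - n₁ - n₂ = -(n₁ + n₂) + n₃ by ring, zpow_add, mul_assoc,
        e', zpow_neg, inv_mul_cancel_left]
    rw [this]
    exact ((hs.mul hq₁).mul hq₂).mul hq₃.inv
  · have hd := hφ.nonneg
    have t : |(2 * K : ℕ) * (φ a + φ b - φ (a * b))| ≤
        |((n₃ - n₁ - n₂ : ℤ) : ℝ)| + 2 * d * d₁ + 2 * d * d₂ + 2 * d * d₃ := by
      rw [show ((2 * K : ℕ) : ℝ) * (φ a + φ b - φ (a * b)) = -((n₃ - n₁ - n₂ : ℤ) : ℝ)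
        + ((2 * K : ℕ) * φ a - n₁) + ((2 * K : ℕ) * φ b - n₂)
        + -((2 * K : ℕ) * φ (a * b) - n₃) by push_cast; ring]
      refine (abs_add_le _ _).trans (add_le_add ((abs_add_le _ _).trans
        (add_le_add ((abs_add_le _ _).trans (add_le_add ?_ b₁)) b₂)) ?_)
      · rw [abs_neg]
      · rwa [abs_neg]
    rw [abs_mul, Nat.abs_cast] at t
    have t₁ := mul_le_mul_of_nonneg_left hd₁ hd
    have t₂ := mul_le_mul_of_nonneg_left hd₂ hd
    have t₃ := mul_le_mul_of_nonneg_left hd₃ hd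
    linarith

/-- If `scl` vanishes on the quotient, `scl` on the extension is at most the value of `φ` divided by
twice the additivity failure of `φ` at any pair. -/
theorem stableCl_mul_le (hφ : IsCentralQuasimorphism π T φ d) (hH : ∀ h : H, scl h = 0)
    {g : Γ} (hg : g ∈ commutator Γ) (a b : Γ) :
    2 * |φ a + φ b - φ (a * b)| * stableCl g ≤ |φ g| := by
  have hs := stableCl_nonneg hg
  have hd := hφ.nonneg
  set δ := |φ a + φ b - φ (a * b)|
  have bound : ∀ ε : ℝ, 0 < ε →
      (δ - 6 * d * ε) * (stableCl g - ε) ≤ (1 / 2 + 3 * ε) * (|φ g| + 2 * d * ε) := by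
    intro ε hε
    obtain ⟨K, M, n, hK, hn, hM, hle⟩ := hφ.exists_isCommProd_zpow hH a b hε
    obtain ⟨k, c, m, p, hk, hc, hp, h⟩ := hφ.exists_pow_eq hH g hε
    have hK0 : (0 : ℝ) < K := by exact_mod_cast hK
    have hk0 : (0 : ℝ) < k := by exact_mod_cast hk
    have hR : 0 ≤ (1 / 2 + 3 * ε) * (|φ g| + 2 * d * ε) := by positivity
    -- Unless both factors on the left are positive, the bound is elementary. If both are negative,
    -- their product is at most `6 * d * ε * ε`, a term of the expanded right side.
    rcases le_or_gt (stableCl g - ε) 0 with h0 | h0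
    · rcases le_or_gt 0 (δ - 6 * d * ε) with h1 | h1
      · exact (mul_nonpos_of_nonneg_of_nonpos h1 h0).trans hR
      · have h3 : 0 ≤ δ := abs_nonneg _
        have h4 : (6 * d * ε - δ) * (ε - stableCl g) ≤ 6 * d * ε * ε :=
          mul_le_mul (by linarith) (by linarith) (by linarith) (by positivity)
        nlinarith [mul_nonneg hd hε.le, abs_nonneg (φ g), mul_nonneg hε.le (abs_nonneg (φ g))]
    rcases le_or_gt (δ - 6 * d * ε) 0 with h1 | h1
    · exact (mul_nonpos_of_nonpos_of_nonneg h1 h0.le).trans hR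
    have hMpos : (0 : ℝ) < |(M : ℝ)| := (mul_pos hK0 h1).trans_le hle
    have hMn : (M.natAbs : ℝ) = |(M : ℝ)| := by rw [Nat.cast_natAbs, Int.cast_abs]
    have hmn : (m.natAbs : ℝ) = |(m : ℝ)| := by rw [Nat.cast_natAbs, Int.cast_abs]
    have hM1 : 1 ≤ M.natAbs := by
      rw [← hMn] at hMpos
      exact_mod_cast hMpos
    -- Only `T ^ M` is known to be a product of commutators, so `g ^ k = T ^ m * p` is raised to the
    -- power `|M|`, making its central part a power of `T ^ M`.
    have hT : IsCommProd (m.natAbs * n) (T ^ (m * (M.natAbs : ℤ))) := by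
      rcases M.natAbs_eq with e | e
      · rw [← e, mul_comm m M, zpow_mul]
        exact hM.zpow m
      · rw [show m * (M.natAbs : ℤ) = M * -m by rw [mul_comm, mul_neg, ← neg_mul]; congr 1; omega,
          zpow_mul, ← m.natAbs_neg]
        exact hM.zpow (-m)
    have hcl : cl (g ^ (k * M.natAbs)) ≤ m.natAbs * n + M.natAbs * c := by
      rw [pow_mul, h, hφ.pow_zpow_mul]
      exact (hT.mul (hp.pow _)).cl_le
    have h2 := stableCl_le_cl (pow_mem hg (k * M.natAbs))
    rw [stableCl_pow hg (Nat.mul_pos hk hM1)] at h2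
    replace h2 := h2.trans (Nat.cast_le.2 hcl)
    simp only [Nat.cast_add, Nat.cast_mul] at h2
    rw [hMn, hmn] at h2
    -- `k |M| (stableCl g - ε) ≤ |m| n`, `|m| ≤ k (|φ g| + 2 d ε)`
    have h3 : |(m : ℝ)| ≤ k * (|φ g| + 2 * d * ε) := by
      have := hφ.abs_sub_le hp h
      have h4 : |(m : ℝ)| ≤ |k * φ g| + |k * φ g - m| := by
        have := abs_sub (k * φ g) (k * φ g - m)
        simpa using this
      rw [abs_mul, Nat.abs_cast] at h4
      nlinarith [mul_le_mul_of_nonneg_left hc hd]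
    have h4 : k * |(M : ℝ)| * (stableCl g - ε) ≤ |(m : ℝ)| * n := by
      nlinarith [mul_le_mul_of_nonneg_left hc hMpos.le]
    have h5 : |(m : ℝ)| * n ≤ k * (|φ g| + 2 * d * ε) * ((1 / 2 + 3 * ε) * K) :=
      mul_le_mul h3 hn (by positivity) (by positivity)
    have h6 : k * (K * (δ - 6 * d * ε)) * (stableCl g - ε) ≤ k * |(M : ℝ)| * (stableCl g - ε) := by
      gcongr
    have h7 := (h6.trans h4).trans h5
    refine le_of_mul_le_mul_left ?_ (mul_pos hk0 hK0)
    linarith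
  have lim : (δ - 6 * d * 0) * (stableCl g - 0) ≤ (1 / 2 + 3 * 0) * (|φ g| + 2 * d * 0) := by
    refine le_of_tendsto_of_tendsto (b := 𝓝[>] (0 : ℝ))
      (f := fun ε => (δ - 6 * d * ε) * (stableCl g - ε))
      (g := fun ε => (1 / 2 + 3 * ε) * (|φ g| + 2 * d * ε)) ?_ ?_
      (eventually_mem_nhdsWithin.mono bound)
    · exact (Continuous.tendsto (by fun_prop) 0).mono_left nhdsWithin_le_nhds
    · exact (Continuous.tendsto (by fun_prop) 0).mono_left nhdsWithin_le_nhds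
  linarith

end IsCentralQuasimorphism

end Extension


/-! ### The total lift as a central extension -/

theorem coe_eq_coe_iff {x y : ℝ} : (x : UnitAddCircle) = y ↔ ∃ m : ℤ, y = m + x := by
  rw [← sub_eq_zero, ← AddCircle.coe_sub, AddCircle.coe_eq_zero_iff]
  constructor
  · rintro ⟨n, hn⟩
    refine ⟨-n, ?_⟩
    rw [zsmul_one] at hn
    push_cast
    linarith
  · rintro ⟨m, rfl⟩
    exact ⟨-m, by simp⟩

/-- A degree one lift of the identity of the circle is an integer translation. -/
theorem exists_int_add_of_coe_eq (F : CircleDeg1Lift)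
    (hF : ∀ x : ℝ, ((F x : ℝ) : UnitAddCircle) = x) :
    ∃ m : ℤ, ∀ x, F x = m + x := by
  -- The integer `n x` cannot decrease over a step shorter than 1, and it is 1-periodic, hence
  -- constant.
  choose n hn using fun x => coe_eq_coe_iff.1 (hF x).symm
  have mono : ∀ x y, x ≤ y → y < x + 1 → n x ≤ n y := by
    intro x y hxy hy
    have := F.monotone hxy
    rw [hn, hn] at this
    have : (n x : ℝ) < n y + 1 := by linarith
    exact Int.lt_add_one_iff.1 (by exact_mod_cast this)
  have per : ∀ x, n (x + 1) = n x := by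
    intro x
    have := F.map_add_one x
    rw [hn, hn] at this
    have : (n (x + 1) : ℝ) = n x := by linarith
    exact_mod_cast this
  have le : ∀ x y, 0 ≤ x → x ≤ y → y < 1 → n x = n y := by
    intro x y h0 hxy hy
    have h2 : n y ≤ n (x + 1) := by
      rcases hxy.eq_or_lt with rfl | h
      · rw [per]
      · exact mono _ _ (by linarith) (by linarith)
    rw [per] at h2
    exact le_antisymm (mono _ _ hxy (by linarith)) h2
  refine ⟨n 0, fun x => ?_⟩
  have h1 := F.map_fract_sub_fract_eq x
  rw [hn (Int.fract x), ← le 0 (Int.fract x) le_rfl (Int.fract_nonneg x) (Int.fract_lt_one x)] at h1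
  linarith

/-- The translation by `1`. -/
noncomputable def unitTranslation : LiftedHomeoPlus :=
  CircleDeg1Lift.translate (Multiplicative.ofAdd 1)

theorem unitTranslation_zpow_apply (m : ℤ) (x : ℝ) :
    (unitTranslation ^ m : LiftedHomeoPlus) x = m + x := by
  rw [unitTranslation, CircleDeg1Lift.translate_zpow, CircleDeg1Lift.translate_apply, mul_one]

theorem commute_unitTranslation (f : LiftedHomeoPlus) : Commute unitTranslation f := by
  refine Units.ext (CircleDeg1Lift.ext fun x => ?_)
  simp [unitTranslation]

theorem exists_zpow_of_eta_eq_one {f : LiftedHomeoPlus} (hf : eta f = 1) :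
    ∃ m : ℤ, f = unitTranslation ^ m := by
  obtain ⟨m, hm⟩ := exists_int_add_of_coe_eq f fun x =>
    congrArg (fun h : HomeoPlus => (h : UnitAddCircle ≃ₜ UnitAddCircle) (x : UnitAddCircle)) hf
  exact ⟨m, Units.ext (CircleDeg1Lift.ext fun x => by rw [hm, unitTranslation_zpow_apply])⟩

theorem eta_unitTranslation_zpow (m : ℤ) : eta (unitTranslation ^ m) = 1 := by
  ext x
  induction x using QuotientAddGroup.induction_on with | H x => ?_
  change (((unitTranslation ^ m : LiftedHomeoPlus) x : ℝ) : UnitAddCircle) = (x : UnitAddCircle)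
  rw [unitTranslation_zpow_apply]
  exact (coe_eq_coe_iff.2 ⟨m, rfl⟩).symm

/-- A cyclic order preserving self-map of the circle lifts to a degree one map of the line. -/
theorem exists_circleDeg1Lift (f : HomeoPlus) : ∃ F : CircleDeg1Lift, ∀ x : ℝ,
    ((F x : ℝ) : UnitAddCircle) = (f : UnitAddCircle ≃ₜ UnitAddCircle) (x : UnitAddCircle) := by
  have hp : (0 : ℝ) < 1 := one_pos
  obtain ⟨f, hf⟩ := f
  choose g hg using fun x : ℝ => QuotientAddGroup.mk_surjective (f (x : UnitAddCircle))
  -- Representatives of the image are taken in `[g 0, g 0 + 1)`; cyclic order then makes `r`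
  -- monotone on `[0, 1)`.
  let r : ℝ → ℝ := fun x => toIcoMod hp (g 0) (g x)
  have hr : ∀ x, ((r x : ℝ) : UnitAddCircle) = f (x : UnitAddCircle) := by
    intro x
    rw [← hg x]
    refine coe_eq_coe_iff.2 ⟨toIcoDiv hp (g 0) (g x), ?_⟩
    have := toIcoMod_add_toIcoDiv_zsmul hp (g 0) (g x)
    rw [zsmul_one] at this
    change g x = _ + toIcoMod hp (g 0) (g x)
    linarith
  have hr1 : ∀ x y, r y < r x + 1 := fun x y =>
    (toIcoMod_lt_right hp _ _).trans_le (by gcongr; exact left_le_toIcoMod hp _ _)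
  have hmono : ∀ x y, 0 ≤ x → x ≤ y → y < 1 → r x ≤ r y := by
    intro x y hx hxy hy
    rcases hxy.eq_or_lt with rfl | hlt
    · rfl
    have hb : btw ((0 : ℝ) : UnitAddCircle) (x : UnitAddCircle) (y : UnitAddCircle) := by
      erw [QuotientAddGroup.btw_coe_iff]
      rw [(toIcoMod_eq_self hp).2 ⟨hx, by linarith⟩,
        (toIocMod_eq_self hp).2 ⟨by linarith, by linarith⟩]
      exact hxy
    have hb' := (hf _ _ _).2 hb
    rw [← hg 0, ← hg x, ← hg y] at hb'
    erw [QuotientAddGroup.btw_coe_iff] at hb'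
    refine hb'.trans (le_of_eq ?_)
    -- The half-open representatives `Ico` and `Ioc` differ only at the base point, and `f y = f 0`
    -- contradicts injectivity since `0 < y < 1`.
    refine ((toIocMod_eq_iff hp).2 ⟨⟨lt_of_le_of_ne (left_le_toIcoMod hp _ _) fun h => ?_,
      (toIcoMod_lt_right hp _ _).le⟩, toIcoDiv hp (g 0) (g y),
      (toIcoMod_add_toIcoDiv_zsmul hp _ _).symm⟩)
    have h1 : ((g 0 : ℝ) : UnitAddCircle) = f (y : UnitAddCircle) := by
      rw [h]
      exact hr y
    obtain ⟨m, hm⟩ := coe_eq_coe_iff.1 (f.injective ((hg 0).symm.trans h1))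
    rw [add_zero] at hm
    have h2 : (0 : ℤ) < m := by exact_mod_cast (show (0 : ℝ) < m by linarith)
    have h3 : m < (1 : ℤ) := by exact_mod_cast (show (m : ℝ) < 1 by linarith)
    omega
  refine ⟨⟨⟨fun x => r (Int.fract x) + ⌊x⌋, fun x y hxy => ?_⟩, fun x => ?_⟩, fun x => ?_⟩
  · rcases (Int.floor_mono hxy).eq_or_lt with h | h
    · have : Int.fract x ≤ Int.fract y := by
        rw [Int.fract, Int.fract, h]; linarith
      have := hmono _ _ (Int.fract_nonneg x) this (Int.fract_lt_one y)
      simp only [h]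
      linarith
    · have h1 : (⌊x⌋ : ℝ) + 1 ≤ ⌊y⌋ := by exact_mod_cast h
      have := hr1 (Int.fract y) (Int.fract x)
      simp only
      linarith
  · simp [add_assoc]
  · change ((r (Int.fract x) + ⌊x⌋ : ℝ) : UnitAddCircle) = f x
    have h1 : ((r (Int.fract x) + ⌊x⌋ : ℝ) : UnitAddCircle) = (r (Int.fract x) : ℝ) :=
      (coe_eq_coe_iff.2 ⟨⌊x⌋, add_comm _ _⟩).symm
    rw [h1, hr]
    congr 1
    exact coe_eq_coe_iff.2 ⟨⌊x⌋, (Int.floor_add_fract x).symm⟩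

/-- Lifts of `f` and `f⁻¹` compose, in either order, to lifts of the identity, that is, to integer
translations; this forces bijectivity. -/
theorem eta_surjective : Function.Surjective eta := by
  intro f
  obtain ⟨F, hF⟩ := exists_circleDeg1Lift f
  obtain ⟨F', hF'⟩ := exists_circleDeg1Lift f⁻¹
  have h1 : ∀ x : ℝ, (((F * F') x : ℝ) : UnitAddCircle) = x := by
    intro x
    rw [CircleDeg1Lift.mul_apply, hF, hF']
    exact (f : UnitAddCircle ≃ₜ UnitAddCircle).apply_symm_apply _
  have h2 : ∀ x : ℝ, (((F' * F) x : ℝ) : UnitAddCircle) = x := by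
    intro x
    rw [CircleDeg1Lift.mul_apply, hF', hF]
    exact (f : UnitAddCircle ≃ₜ UnitAddCircle).symm_apply_apply _
  obtain ⟨m, hm⟩ := exists_int_add_of_coe_eq _ h1
  obtain ⟨n, hn⟩ := exists_int_add_of_coe_eq _ h2
  have hu : IsUnit F := by
    refine CircleDeg1Lift.isUnit_iff_bijective.2 ⟨fun x y h => ?_, fun y => ⟨F' (y - m), ?_⟩⟩
    · have hx := hn x
      rw [CircleDeg1Lift.mul_apply, h, ← CircleDeg1Lift.mul_apply, hn] at hx
      linarith
    · rw [← CircleDeg1Lift.mul_apply, hm]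
      ring
  obtain ⟨u, rfl⟩ := hu
  refine ⟨u, ?_⟩
  ext x
  induction x using QuotientAddGroup.induction_on with | H x => exact hF x

theorem rot_zpow_mul (m : ℤ) (f : LiftedHomeoPlus) : rot (unitTranslation ^ m * f) = m + rot f := by
  have h := CircleDeg1Lift.translationNumber_mul_of_commute
    (((commute_unitTranslation f).zpow_left m).units_val)
  rw [rot, Units.val_mul, h, CircleDeg1Lift.translationNumber_zpow, unitTranslation,
    CircleDeg1Lift.translationNumber_translate, mul_one, rot]

/-- Each of the three rotation numbers is within 1 of the value at 0, and `f (g 0)` is within 1 of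
`f 0 + g 0`. The bound is crude, but only finiteness of the defect matters. -/
theorem abs_rot_add_rot_sub_le (f g : LiftedHomeoPlus) : |rot f + rot g - rot (f * g)| ≤ 4 := by
  have h1 := CircleDeg1Lift.dist_map_zero_translationNumber_le (f : CircleDeg1Lift)
  have h2 := CircleDeg1Lift.dist_map_zero_translationNumber_le (g : CircleDeg1Lift)
  have h3 := CircleDeg1Lift.dist_map_zero_translationNumber_le
    ((f * g : LiftedHomeoPlus) : CircleDeg1Lift)
  have h4 := CircleDeg1Lift.dist_map_map_zero_lt (f : CircleDeg1Lift) g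
  rw [Real.dist_eq, abs_le] at h1 h2 h3
  rw [Real.dist_eq, abs_lt] at h4
  rw [Units.val_mul, CircleDeg1Lift.mul_apply] at h3
  simp only [rot, Units.val_mul]
  rw [abs_le]
  constructor <;> linarith [h1.1, h1.2, h2.1, h2.2, h3.1, h3.2, h4.1, h4.2]

theorem defect_ne_top_of_forall_le {Γ : Type*} [Group Γ] {φ : Γ → ℝ} {d : ℝ}
    (h : ∀ g h, |φ g + φ h - φ (g * h)| ≤ d) : defect φ ≠ ∞ :=
  ne_top_of_le_ne_top ENNReal.ofReal_ne_top
    (iSup₂_le fun g k => ENNReal.ofReal_le_ofReal (h g k))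

theorem le_toReal_defect {Γ : Type*} [Group Γ] {φ : Γ → ℝ} (h : defect φ ≠ ∞) (g k : Γ) :
    |φ g + φ k - φ (g * k)| ≤ (defect φ).toReal :=
  (ENNReal.ofReal_le_iff_le_toReal h).1
    (le_iSup₂ (f := fun g k => ENNReal.ofReal |φ g + φ k - φ (g * k)|) g k)

/-- The projection of the total lift of `G` onto `G`. -/
noncomputable def totalLiftProj (G : Subgroup HomeoPlus) : totalLift G →* G := eta.subgroupComap G

/-- The translation by `1` as an element of the total lift. -/
noncomputable def totalLiftTranslation (G : Subgroup HomeoPlus) : totalLift G :=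
  ⟨unitTranslation, by
    rw [totalLift, Subgroup.mem_comap, ← zpow_one unitTranslation, eta_unitTranslation_zpow]
    exact one_mem G⟩

theorem isCentralQuasimorphism_rot (G : Subgroup HomeoPlus) :
    IsCentralQuasimorphism (totalLiftProj G) (totalLiftTranslation G)
      (fun g : totalLift G => rot g) (defect fun g : totalLift G => rot g).toReal where
  surjective := by
    rintro ⟨g, hg⟩
    obtain ⟨f, rfl⟩ := eta_surjective g
    exact ⟨⟨f, hg⟩, rfl⟩
  commute g := Subtype.ext (commute_unitTranslation g)
  exists_zpow g hg := by
    obtain ⟨m, hm⟩ := exists_zpow_of_eta_eq_one (congrArg Subtype.val hg)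
    exact ⟨m, Subtype.ext hm⟩
  map_pow g n := CircleDeg1Lift.translationNumber_pow _ n
  map_inv g := CircleDeg1Lift.translationNumber_units_inv _
  map_conj g h := CircleDeg1Lift.translationNumber_conj_eq _ _
  map_zpow_mul m g := rot_zpow_mul m g
  defect_le := le_toReal_defect (defect_ne_top_of_forall_le fun g h => abs_rot_add_rot_sub_le g h)

end CircleScl

/-- If `scl` vanishes everywhere on `G ≤ Homeo⁺(ℝ/ℤ)` and `D` is the defect of the rotation number
on the total lift of `G`, then `D = 0`, or `scl g = |rot g| / (2 D)` for all `g` in the commutator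
subgroup of the total lift. -/
theorem theorem2p6 (G : Subgroup CircleScl.HomeoPlus)
    (hG : ∀ g : G, CircleScl.scl g = 0) (D : ℝ≥0∞)
    (hD : D = CircleScl.defect fun g : CircleScl.totalLift G => CircleScl.rot g) :
    D = 0 ∨ ∀ g : CircleScl.totalLift G, g ∈ commutator (CircleScl.totalLift G) →
      CircleScl.scl g = ENNReal.ofReal |CircleScl.rot g| / (2 * D) := by
  have hφ := CircleScl.isCentralQuasimorphism_rot G
  have htop : D ≠ ∞ := hD ▸ CircleScl.defect_ne_top_of_forall_le (d := 4)
    fun g h => CircleScl.abs_rot_add_rot_sub_le g h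
  rw [← hD] at hφ
  refine or_iff_not_imp_left.2 fun h0 g hg => ?_
  have hs := CircleScl.stableCl_nonneg hg
  have hlow := hφ.abs_le_stableCl hg
  rw [CircleScl.scl_of_mem_commutator hg, ENNReal.eq_div_iff (by simpa using h0)
    (ENNReal.mul_ne_top ENNReal.ofNat_ne_top htop)]
  refine le_antisymm ?_ ?_
  -- Multiplication in `ℝ≥0∞` commutes with suprema, so the bound for each pair `a`, `b` suffices.
  · rw [hD, CircleScl.defect, mul_assoc, ENNReal.iSup_mul, ENNReal.mul_iSup]
    refine iSup_le fun a => ?_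
    rw [ENNReal.iSup_mul, ENNReal.mul_iSup]
    refine iSup_le fun b => ?_
    rw [← ENNReal.ofReal_mul (abs_nonneg _), ← ENNReal.ofReal_ofNat 2,
      ← ENNReal.ofReal_mul (by norm_num), ← mul_assoc]
    exact ENNReal.ofReal_le_ofReal (hφ.stableCl_mul_le hG hg a b)
  · calc ENNReal.ofReal |CircleScl.rot g|
        ≤ ENNReal.ofReal (2 * D.toReal * CircleScl.stableCl g) := ENNReal.ofReal_le_ofReal hlow
      _ = 2 * D * ENNReal.ofReal (CircleScl.stableCl g) := by
        rw [ENNReal.ofReal_mul (by positivity), ENNReal.ofReal_mul (by norm_num),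
          ENNReal.ofReal_toReal htop, ENNReal.ofReal_ofNat]
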